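/- All trees are finite, rooted and plane, i.e. the children of each node are linearly ordered from left to right. A tree is regarded as a poset on its nodes in which $x\le y$ if and only if $y=x$ or $y$ is an ancestor of $x$, so that the root is the maximum. An embedding of $S$ into $T$ is a subposet $P$ of $T$ that is isomorphic to $S$ in such a way that the left-to-right order of the children of each node of $S$ is inherited from $T$; it is good if it contains the root of $T$. Let $a_T(S)$ and $g_T(S)$ be the number of all embeddings and of good embeddings of $S$ into $T$, and write $S\subseteq T$ if $a_T(S)\ge 1$. Let $\mathcal B_n$ be the set of plane binary trees (every node has $0$ or $2$ children) with $n$ nodes, and put $a_{\mathcal B_n}(S)=\sum_{T\in\mathcal B_n}a_T(S)$ and $g_{\mathcal B_n}(S)=\sum_{T\in\mathcal B_n}g_T(S)$. **Theorem.** Let $S_1,S_2$ be rooted plane trees with $S_1\subseteq S_2$. Then $a_{\mathcal B_n}(S_1)$ and $a_{\mathcal B_n}(S_2)$ are positive for all sufficiently large odd $n$, both limits below exist in $\mathbb R$, and $$\lim_{\substack{n\to\infty\\ n\text{ odd}}}\sqrt n\,\frac{g_{\mathcal B_n}(S_1)}{a_{\mathcal B_n}(S_1)}\;\le\;\lim_{\substack{n\to\infty\\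 n\text{ odd}}}\sqrt n\,\frac{g_{\mathcal B_n}(S_2)}{a_{\mathcal B_n}(S_2)}.$$ -/

import Mathlib

/-- Finite rooted plane trees: a root together with the ordered list of the subtrees
of its children. -/
inductive PlaneTree : Type where
  | node : List PlaneTree → PlaneTree

namespace PlaneTree

/-- `T.IsNode p` says that the address `p` is a node of `T`. The root has address `[]`, and
`i :: p` is the node with address `p` of the `i`-th subtree (from left to right, from `0`). -/
def IsNode : PlaneTree → List ℕ → Prop
  | _, [] => True
  | node ts, i :: p => ∃ h : i < ts.length, IsNode (ts[i]) p

/-- The nodes of a plane tree. -/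
@[ext]
structure Vertex (T : PlaneTree) : Type where
  address : List ℕ
  isNode : T.IsNode address

/-- The tree order, with the root as the maximal element: `x ≤ y` if `y` is equal to `x` or
an ancestor of `x`. -/
instance (T : PlaneTree) : PartialOrder T.Vertex where
  le x y := y.address <+: x.address
  le_refl x := List.prefix_refl x.address
  le_trans _ _ _ hxy hyz := hyz.trans hxy
  le_antisymm _ _ hxy hyx := Vertex.ext (hyx.eq_of_length_le hxy.length_le)

/-- The root of a plane tree. -/
def root (T : PlaneTree) : T.Vertex := ⟨[], by cases T; simp [IsNode]⟩

/-- Two nodes are incomparable and `x` is to the left of `y`: at their last common ancestor `q`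
they lie below different children `i < j`. -/
def Vertex.LeftOf {T : PlaneTree} (x y : T.Vertex) : Prop :=
  ∃ (q s t : List ℕ) (i j : ℕ), i < j ∧ x.address = q ++ i :: s ∧ y.address = q ++ j :: t

/-- `x` and `y` are children of the same node, and `x` is to the left of `y`. -/
def Vertex.LeftSibling {T : PlaneTree} (x y : T.Vertex) : Prop :=
  ∃ (q : List ℕ) (i j : ℕ), i < j ∧ x.address = q ++ [i] ∧ y.address = q ++ [j]

/-- Plane embeddings of `S` into `T`: the subposets `P` of `T` which are isomorphic to `S` in such
a way that the left-to-right order of the children of each node of `S` is inherited from `T`. -/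
def IsEmbedding (S T : PlaneTree) (P : Set T.Vertex) : Prop :=
  ∃ e : S.Vertex ≃o P, ∀ x y : S.Vertex, x.LeftSibling y → (e x : T.Vertex).LeftOf (e y)

/-- `S ⊆ T`: there is at least one embedding of `S` into `T`. -/
def Embeds (S T : PlaneTree) : Prop :=
  ∃ P : Set T.Vertex, IsEmbedding S T P

/-- The number of nodes. -/
noncomputable def size (T : PlaneTree) : ℕ := Nat.card T.Vertex

/-- The number of all embeddings of `S` into `T`. -/
noncomputable def numAll (T S : PlaneTree) : ℕ :=
  {P : Set T.Vertex | IsEmbedding S T P}.ncard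

/-- The number of good embeddings of `S` into `T`: those which contain the root of `T`. -/
noncomputable def numGood (T S : PlaneTree) : ℕ :=
  {P : Set T.Vertex | IsEmbedding S T P ∧ T.root ∈ P}.ncard

/-- Binary trees: each node has either no child or two children. -/
inductive IsBinary : PlaneTree → Prop where
  | leaf : IsBinary (node [])
  | branch (L R : PlaneTree) : IsBinary L → IsBinary R → IsBinary (node [L, R])

/-- A plane tree has finitely many nodes, so that `size`, `numAll` and `numGood` are
honest cardinalities. -/
instance finite_vertex : ∀ T : PlaneTree, Finite T.Vertex
  | node ts => by
    have ih : ∀ i : Fin ts.length, Finite (ts[i]).Vertex := fun i => finite_vertex (ts[i])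
    let f : Option (Σ i : Fin ts.length, (ts[i]).Vertex) → (node ts).Vertex
      | none => root _
      | some ⟨i, v⟩ => ⟨i :: v.address, by
          rw [IsNode]; exact ⟨i.2, v.isNode⟩⟩
    refine Finite.of_surjective f ?_
    rintro ⟨p, hp⟩
    match p, hp with
    | [], _ => exact ⟨none, rfl⟩
    | i :: p, hp =>
      rw [IsNode] at hp
      obtain ⟨h, hp⟩ := hp
      exact ⟨some ⟨⟨i, h⟩, ⟨p, hp⟩⟩, rfl⟩
termination_by T => T
decreasing_by
  simp_wf
  have := List.sizeOf_lt_of_mem (List.getElem_mem i.2)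
  simp at this ⊢
  omega

lemma size_lt_of_mem {ts : List PlaneTree} {t : PlaneTree} (ht : t ∈ ts) :
    t.size < (node ts).size := by
  obtain ⟨i, hi, rfl⟩ := List.getElem_of_mem ht
  let f : (ts[i]).Vertex → (node ts).Vertex := fun v =>
    ⟨i :: v.address, by rw [IsNode]; exact ⟨hi, v.isNode⟩⟩
  have := Fintype.ofFinite (ts[i]).Vertex
  have := Fintype.ofFinite (node ts).Vertex
  rw [size, size, Nat.card_eq_fintype_card, Nat.card_eq_fintype_card]
  refine Fintype.card_lt_of_injective_of_notMem f (b := root _) ?_ ?_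
  · intro v w h
    have := congrArg Vertex.address h
    exact Vertex.ext (by simpa [f] using this)
  · rintro ⟨v, hv⟩
    have := congrArg Vertex.address hv
    simp [f, root] at this

lemma finite_binary (n : ℕ) : {T : PlaneTree | T.IsBinary ∧ T.size = n}.Finite := by
  suffices h : ∀ n : ℕ, {T : PlaneTree | T.IsBinary ∧ T.size < n}.Finite from
    (h (n + 1)).subset fun T hT => ⟨hT.1, by have := hT.2; omega⟩
  intro n
  induction n with
  | zero => simp
  | succ n ih =>
    refine ((Set.finite_singleton (node [])).union
      (ih.image2 (fun L R => node [L, R]) ih)).subset ?_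
    rintro T ⟨hb, hs⟩
    cases hb with
    | leaf => exact Or.inl rfl
    | branch L R hL hR =>
      have h1 : L.size < (node [L, R]).size := size_lt_of_mem (by simp)
      have h2 : R.size < (node [L, R]).size := size_lt_of_mem (by simp)
      exact Or.inr ⟨L, ⟨hL, by omega⟩, R, ⟨hR, by omega⟩, rfl⟩

/-- The family of plane binary trees with `n` nodes. -/
noncomputable def binaryTrees (n : ℕ) : Finset PlaneTree := (finite_binary n).toFinset

/-- The cumulative number of embeddings of `S` into the plane binary trees with `n` nodes. -/
noncomputable def allB (n : ℕ) (S : PlaneTree) : ℕ := ∑ T ∈ binaryTrees n, numAll T S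

/-- The cumulative number of good embeddings of `S` into the plane binary trees with `n` nodes. -/
noncomputable def goodB (n : ℕ) (S : PlaneTree) : ℕ := ∑ T ∈ binaryTrees n, numGood T S

/-- The quantity `√n · g_{B_n}(S) / a_{B_n}(S)`. -/
noncomputable def scaledRatio (S : PlaneTree) (n : ℕ) : ℝ :=
  Real.sqrt (n : ℝ) * ((goodB n S : ℝ) / (allB n S : ℝ))

/-- The odd `n` tending to infinity. -/
def oddAtTop : Filter ℕ := Filter.atTop ⊓ Filter.principal {n : ℕ | Odd n}

end PlaneTree

/-!
An embedding of plane trees is the same as a map between the nodes which preserves the strict order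
and the relation of being incomparable and further to the left. Such maps are determined by their
image and can be counted recursively along the decomposition of a tree into its root and the ordered
forest below it.

For binary trees the recursion becomes a system of equations between generating functions, with `X`
marking inner nodes, in which `w = √(1 - 4X)` plays the main role: the generating function of the
good embeddings of `S` is `w` times that of all embeddings, and the latter is a positive multiple of
`w ^ (-p) * (1 - w) ^ q / X`, where `p + 1` is the number of nodes plus the number of leaves of `S`.
The asymptotics of the coefficients give the limit `√2 * Γ(p / 2) / Γ((p - 1) / 2)`. It is
increasing in `p` because `log Γ` is convex, and a tree which embeds into another one has at most as
many nodes and at most as many leaves.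
-/

open Filter Topology PowerSeries
open Finset.HasAntidiagonal (antidiagonal mem_antidiagonal)

/-! ### Asymptotics of binomial series -/

theorem add_le_add_of_convexOn {𝕜 : Type*} [Field 𝕜] [LinearOrder 𝕜] [IsStrictOrderedRing 𝕜]
    {s : Set 𝕜} {f : 𝕜 → 𝕜} (hf : ConvexOn 𝕜 s f) {x y d : 𝕜} (hx : x ∈ s) (hyd : y + d ∈ s)
    (hxy : x ≤ y) (hd : 0 ≤ d) : f (x + d) + f y ≤ f x + f (y + d) := by
  obtain hlen | hlen := (add_nonneg (sub_nonneg.2 hxy) hd).eq_or_lt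
  · obtain rfl : x = y := by linarith
    obtain rfl : d = 0 := by linarith
    exact (add_comm _ _).le
  have hlen' := hlen.ne'
  have ha : 0 ≤ (y - x) / (y - x + d) := div_nonneg (sub_nonneg.2 hxy) hlen.le
  have hb : 0 ≤ d / (y - x + d) := div_nonneg hd hlen.le
  have hab : (y - x) / (y - x + d) + d / (y - x + d) = 1 := by rw [← add_div, div_self hlen']
  have hxd := hf.2 hx hyd ha hb hab
  have hy := hf.2 hx hyd hb ha (by rwa [add_comm])
  simp only [smul_eq_mul] at hxd hy
  rw [show (y - x) / (y - x + d) * x + d / (y - x + d) * (y + d) = x + d by field_simp; ring] at hxd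
  rw [show d / (y - x + d) * x + (y - x) / (y - x + d) * (y + d) = y by field_simp; ring] at hy
  linear_combination hxd + hy + (f x + f (y + d)) * hab

theorem monotoneOn_Gamma_div_Gamma_sub {d : ℝ} (hd : 0 ≤ d) :
    MonotoneOn (fun s => Real.Gamma s / Real.Gamma (s - d)) (Set.Ici d) := by
  intro s hs t _ hst
  obtain rfl | hs := (Set.mem_Ici.1 hs).eq_or_lt
  · have ht' : 0 ≤ t - d := sub_nonneg.2 hst
    simpa using div_nonneg (Real.Gamma_nonneg_of_nonneg (hd.trans hst))
      (Real.Gamma_nonneg_of_nonneg ht')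
  have hΓ {u : ℝ} (hu : 0 < u) : 0 < Real.Gamma u := Real.Gamma_pos_of_pos hu
  have hsd : 0 < s - d := sub_pos.2 hs
  have htd : 0 < t - d := hsd.trans_le (sub_le_sub_right hst d)
  have hs' : 0 < s := hd.trans_lt hs
  have ht' : 0 < t := hs'.trans_le hst
  have hlog := add_le_add_of_convexOn Real.convexOn_log_Gamma (x := s - d) (y := t - d) (d := d)
    hsd (by simpa using ht') (sub_le_sub_right hst d) hd
  simp only [sub_add_cancel, Function.comp_apply] at hlog
  rw [← Real.log_mul (hΓ hs').ne' (hΓ htd).ne', ← Real.log_mul (hΓ hsd).ne' (hΓ ht').ne',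
    Real.log_le_log_iff (mul_pos (hΓ hs') (hΓ htd)) (mul_pos (hΓ hsd) (hΓ ht'))] at hlog
  change Real.Gamma s / Real.Gamma (s - d) ≤ Real.Gamma t / Real.Gamma (t - d)
  rwa [div_le_div_iff₀ (hΓ hsd) (hΓ htd), mul_comm (Real.Gamma t)]

theorem tendsto_inv_GammaSeq (s : ℝ) :
    Tendsto (fun n => (Real.GammaSeq s n)⁻¹) atTop (𝓝 (Real.Gamma s)⁻¹) := by
  by_cases hs : Real.Gamma s = 0
  · obtain ⟨m, rfl⟩ := (Real.Gamma_eq_zero_iff s).1 hs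
    rw [hs, inv_zero]
    refine tendsto_const_nhds.congr' ?_
    filter_upwards [eventually_ge_atTop m] with n hn
    rw [Real.GammaSeq, Finset.prod_eq_zero (i := m) (by simpa [Nat.lt_succ_iff]) (by simp),
      div_zero, inv_zero]
  · exact (Real.GammaSeq_tendsto_Gamma s).inv₀ hs

/-- The binomial series `(1 - X) ^ s` with real exponent. -/
noncomputable def oneSubRpow (s : ℝ) : ℝ⟦X⟧ :=
  rescale (-1 : ℝ) (binomialSeries ℝ s)

theorem oneSubRpow_add (s t : ℝ) : oneSubRpow (s + t) = oneSubRpow s * oneSubRpow t := by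
  simp only [oneSubRpow, binomialSeries_add, map_mul]

theorem oneSubRpow_zero : oneSubRpow 0 = 1 := by
  simp [oneSubRpow]

theorem oneSubRpow_one : oneSubRpow 1 = 1 - X := by
  have h : PowerSeries.binomialSeries ℝ (1 : ℝ) = 1 + X := by
    simpa using binomialSeries_nat (R := ℝ) (A := ℝ) 1
  rw [oneSubRpow, h, map_add, map_one, rescale_neg_one_X, sub_eq_add_neg]

theorem constantCoeff_oneSubRpow (s : ℝ) : constantCoeff (oneSubRpow s) = 1 := by
  rw [← coeff_zero_eq_constantCoeff_apply, oneSubRpow, coeff_rescale]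
  simp

theorem coeff_oneSubRpow_neg (s : ℝ) (n : ℕ) :
    coeff n (oneSubRpow (-s)) = (∏ j ∈ Finset.range n, (s + j)) / n.factorial := by
  have hprod : (ascPochhammer ℝ n).eval s = ∏ j ∈ Finset.range n, (s + j) := by
    induction n with
    | zero => simp
    | succ n ih => rw [ascPochhammer_succ_eval, ih, Finset.prod_range_succ]
  have hchoose := Ring.factorial_nsmul_multichoose_eq_ascPochhammer s n
  rw [Polynomial.ascPochhammer_smeval_eq_eval, hprod, nsmul_eq_mul] at hchoose
  rw [← hchoose, mul_div_cancel_left₀ _ (by positivity), oneSubRpow, coeff_rescale,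
    binomialSeries_coeff, Ring.choose_neg', smul_eq_mul, mul_one]
  rcases Nat.even_or_odd n with hn | hn
  · simp [hn.neg_one_pow, Int.negOnePow_even _ (by exact_mod_cast hn : Even (n : ℤ))]
  · simp [hn.neg_one_pow, Int.negOnePow_odd _ (by exact_mod_cast hn : Odd (n : ℤ))]

theorem tendsto_coeff_oneSubRpow_neg (s : ℝ) :
    Tendsto (fun n : ℕ => coeff n (oneSubRpow (-s)) * (n : ℝ) ^ (1 - s)) atTop
      (𝓝 (Real.Gamma s)⁻¹) := by
  have h := (tendsto_inv_GammaSeq s).mul (tendsto_natCast_div_add_atTop s)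
  rw [mul_one] at h
  refine h.congr' ?_
  have hns : ∀ᶠ n : ℕ in atTop, -s < n :=
    tendsto_natCast_atTop_atTop.eventually (eventually_gt_atTop (-s))
  filter_upwards [hns, eventually_gt_atTop 0] with n hns hn
  have hn' : (0 : ℝ) < n := by exact_mod_cast hn
  have hns' : s + n ≠ 0 := by linarith
  rw [coeff_oneSubRpow_neg, Real.GammaSeq, Finset.prod_range_succ, Real.rpow_sub hn',
    Real.rpow_one, add_comm (n : ℝ) s]
  field_simp

theorem tendsto_coeff_oneSubRpow_neg_mul_pow (s : ℝ) (q : ℕ) :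
    Tendsto (fun n : ℕ => coeff n (oneSubRpow (-s) * (1 - oneSubRpow (1 / 2)) ^ q) *
      (n : ℝ) ^ (1 - s)) atTop (𝓝 (Real.Gamma s)⁻¹) := by
  induction q generalizing s with
  | zero => simpa using tendsto_coeff_oneSubRpow_neg s
  | succ q ih =>
    have hzero : Tendsto (fun n : ℕ => (n : ℝ) ^ (-(1 / 2 : ℝ))) atTop (𝓝 0) :=
      (tendsto_rpow_neg_atTop (by norm_num)).comp tendsto_natCast_atTop_atTop
    have h := (ih s).sub ((ih (s - 1 / 2)).mul hzero)
    rw [mul_zero, sub_zero] at h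
    refine h.congr' ?_
    filter_upwards [eventually_gt_atTop 0] with n hn
    have hn' : (0 : ℝ) < n := by exact_mod_cast hn
    have hexp : (1 - (s - 1 / 2)) + -(1 / 2) = 1 - s := by ring
    have hsplit : oneSubRpow (-s) * (1 - oneSubRpow (1 / 2)) ^ (q + 1) =
        oneSubRpow (-s) * (1 - oneSubRpow (1 / 2)) ^ q -
          oneSubRpow (-(s - 1 / 2)) * (1 - oneSubRpow (1 / 2)) ^ q := by
      rw [show -(s - 1 / 2) = -s + 1 / 2 by ring, oneSubRpow_add]
      ring
    rw [hsplit, map_sub, mul_assoc, ← Real.rpow_add hn', hexp, sub_mul]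

/-- The square root `√(1 - 4X)`, the singular part of the generating function of binary trees. -/
noncomputable def sqrtSeries : ℝ⟦X⟧ :=
  rescale (4 : ℝ) (oneSubRpow (1 / 2))

theorem constantCoeff_sqrtSeries : constantCoeff sqrtSeries = 1 := by
  rw [sqrtSeries, ← coeff_zero_eq_constantCoeff_apply, coeff_rescale, pow_zero, one_mul,
    coeff_zero_eq_constantCoeff_apply, constantCoeff_oneSubRpow]

theorem sqrtSeries_ne_zero : sqrtSeries ≠ 0 := fun h => by
  simpa [h] using constantCoeff_sqrtSeries

theorem sqrtSeries_sq : sqrtSeries ^ 2 = 1 - 4 * X := by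
  rw [sqrtSeries, ← map_pow, sq, ← oneSubRpow_add, add_halves, oneSubRpow_one, map_sub, map_one,
    rescale_X, map_ofNat]

theorem eq_sqrtSeries {w : ℝ⟦X⟧} (hw : w ^ 2 = 1 - 4 * X) (hw₀ : constantCoeff w = 1) :
    w = sqrtSeries := by
  rw [← sqrtSeries_sq] at hw
  refine (sq_eq_sq_iff_eq_or_eq_neg.1 hw).resolve_right fun h => ?_
  have h₀ := congrArg constantCoeff h
  rw [hw₀, map_neg, constantCoeff_sqrtSeries] at h₀
  norm_num at h₀

/-- The series `(1 - 4X) ^ (-s) * (1 - √(1 - 4X)) ^ q`. All generating functions below are of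
this form up to a constant and a power of `X`, and `s` alone governs their leading asymptotics. -/
noncomputable def singularSeries (s : ℝ) (q : ℕ) : ℝ⟦X⟧ :=
  rescale (4 : ℝ) (oneSubRpow (-s) * (1 - oneSubRpow (1 / 2)) ^ q)

theorem singularSeries_zero_zero : singularSeries 0 0 = 1 := by
  simp [singularSeries, oneSubRpow_zero]

theorem singularSeries_mul (s t : ℝ) (q r : ℕ) :
    singularSeries s q * singularSeries t r = singularSeries (s + t) (q + r) := by
  rw [singularSeries, singularSeries, singularSeries, ← map_mul, neg_add, oneSubRpow_add, pow_add,
    mul_mul_mul_comm]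

theorem one_sub_sqrtSeries_mul_singularSeries (s : ℝ) (q : ℕ) :
    (1 - sqrtSeries) * singularSeries s q = singularSeries s (q + 1) := by
  rw [singularSeries, singularSeries, sqrtSeries, ← map_one (rescale (4 : ℝ)), ← map_sub,
    ← map_mul, pow_succ', mul_left_comm]
  simp only [map_one]

theorem sqrtSeries_pow_mul_singularSeries (n : ℕ) (s : ℝ) (q : ℕ) :
    sqrtSeries ^ n * singularSeries s q = singularSeries (s - n / 2) q := by
  induction n with
  | zero => simp
  | succ n ih =>
    rw [pow_succ', mul_assoc, ih, sqrtSeries, singularSeries, singularSeries, ← map_mul,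
      ← mul_assoc, ← oneSubRpow_add]
    congr 3
    push_cast
    ring

theorem tendsto_coeff_singularSeries (s : ℝ) (q : ℕ) :
    Tendsto (fun n : ℕ => coeff n (singularSeries s q) / 4 ^ n * (n : ℝ) ^ (1 - s)) atTop
      (𝓝 (Real.Gamma s)⁻¹) := by
  refine (tendsto_coeff_oneSubRpow_neg_mul_pow s q).congr fun n => ?_
  rw [singularSeries, coeff_rescale, mul_div_cancel_left₀ _ (by positivity)]

-- At `s = 1 / 2` the limit is correctly `0`, because of Mathlib's convention `Γ 0 = 0`.
theorem tendsto_coeff_singularSeries_ratio {s : ℝ} (hs : 0 < s) (q : ℕ) :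
    Tendsto (fun n : ℕ =>
      √n * (coeff n (sqrtSeries * singularSeries s q) / coeff n (singularSeries s q))) atTop
      (𝓝 (Real.Gamma s / Real.Gamma (s - 1 / 2))) := by
  have h := (tendsto_coeff_singularSeries (s - 1 / 2) q).div (tendsto_coeff_singularSeries s q)
    (inv_ne_zero (Real.Gamma_pos_of_pos hs).ne')
  rw [inv_div_inv] at h
  refine h.congr' ?_
  filter_upwards [eventually_gt_atTop 0] with n hn
  have hn' : (0 : ℝ) < n := by exact_mod_cast hn
  have hexp : (n : ℝ) ^ (1 - (s - 1 / 2)) = (n : ℝ) ^ (1 - s) * √n := by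
    rw [Real.sqrt_eq_rpow, ← Real.rpow_add hn']
    ring_nf
  have hpow : (n : ℝ) ^ (1 - s) ≠ 0 := (Real.rpow_pos_of_pos hn' _).ne'
  have hmul : sqrtSeries * singularSeries s q = singularSeries (s - 1 / 2) q := by
    simpa using sqrtSeries_pow_mul_singularSeries 1 s q
  rw [Pi.div_apply, hmul, hexp]
  field_simp

theorem eventually_coeff_singularSeries_pos {s : ℝ} (hs : 0 < s) (q : ℕ) :
    ∀ᶠ n : ℕ in atTop, 0 < coeff n (singularSeries s q) := by
  have hΓ : 0 < (Real.Gamma s)⁻¹ := inv_pos.2 (Real.Gamma_pos_of_pos hs)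
  filter_upwards [(tendsto_coeff_singularSeries s q).eventually (lt_mem_nhds hΓ),
    eventually_gt_atTop 0] with n hpos hn
  have hpow := Real.rpow_pos_of_pos (Nat.cast_pos.2 hn : (0 : ℝ) < n) (1 - s)
  exact (div_pos_iff_of_pos_right (by positivity)).1 ((pos_iff_pos_of_mul_pos hpos).2 hpow)

/-- `A` is a positive multiple of `(1 - 4X) ^ (-s) * (1 - √(1 - 4X)) ^ q` for some `q`, so that
its `n`-th coefficient is of order `4 ^ n * n ^ (s - 1)`. -/
def HasSingularExponent (A : ℝ⟦X⟧) (s : ℝ) : Prop :=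
  ∃ (q : ℕ) (c : ℝ), 0 < c ∧ A = C c * singularSeries s q

namespace HasSingularExponent

variable {A B : ℝ⟦X⟧} {s t : ℝ}

theorem one : HasSingularExponent 1 0 :=
  ⟨0, 1, one_pos, by rw [singularSeries_zero_zero, map_one, mul_one]⟩

theorem C_mul {c : ℝ} (hc : 0 < c) (hA : HasSingularExponent A s) :
    HasSingularExponent (C c * A) s := by
  obtain ⟨q, c', hc', rfl⟩ := hA
  exact ⟨q, c * c', mul_pos hc hc', by rw [map_mul, mul_assoc]⟩

theorem mul (hA : HasSingularExponent A s) (hB : HasSingularExponent B t) :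
    HasSingularExponent (A * B) (s + t) := by
  obtain ⟨q, c, hc, rfl⟩ := hA
  obtain ⟨r, d, hd, rfl⟩ := hB
  exact ⟨q + r, c * d, mul_pos hc hd, by
    rw [mul_mul_mul_comm, singularSeries_mul, map_mul]⟩

theorem list_prod {ι : Type*} {f : ι → ℝ⟦X⟧} {e : ι → ℝ} {l : List ι}
    (h : ∀ i ∈ l, HasSingularExponent (f i) (e i)) :
    HasSingularExponent (l.map f).prod (l.map e).sum := by
  induction l with
  | nil => exact one
  | cons i l ih =>
    rw [List.forall_mem_cons] at h
    exact h.1.mul (ih h.2)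

theorem one_sub_sqrtSeries_mul (hA : HasSingularExponent A s) :
    HasSingularExponent ((1 - sqrtSeries) * A) s := by
  obtain ⟨q, c, hc, rfl⟩ := hA
  exact ⟨q + 1, c, hc, by rw [mul_left_comm, one_sub_sqrtSeries_mul_singularSeries]⟩

theorem of_sqrtSeries_pow_mul {n : ℕ} (hA : HasSingularExponent (sqrtSeries ^ n * A) s) :
    HasSingularExponent A (s + n / 2) := by
  obtain ⟨q, c, hc, h⟩ := hA
  refine ⟨q, c, hc, mul_left_cancel₀ (pow_ne_zero n sqrtSeries_ne_zero) ?_⟩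
  rw [h, mul_left_comm, sqrtSeries_pow_mul_singularSeries, add_sub_cancel_right]

theorem of_sqrtSeries_mul (hA : HasSingularExponent (sqrtSeries * A) s) :
    HasSingularExponent A (s + 1 / 2) := by
  rw [← pow_one sqrtSeries] at hA
  exact_mod_cast hA.of_sqrtSeries_pow_mul

theorem eventually_coeff_pos (hA : HasSingularExponent A s) (hs : 0 < s) :
    ∀ᶠ n : ℕ in atTop, 0 < coeff n A := by
  obtain ⟨q, c, hc, rfl⟩ := hA
  filter_upwards [eventually_coeff_singularSeries_pos hs q] with n hn
  simpa only [coeff_C_mul] using mul_pos hc hn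

theorem tendsto_coeff_ratio (hA : HasSingularExponent A s) (hs : 0 < s) :
    Tendsto (fun n : ℕ => √n * (coeff n (sqrtSeries * A) / coeff n A)) atTop
      (𝓝 (Real.Gamma s / Real.Gamma (s - 1 / 2))) := by
  obtain ⟨q, c, hc, rfl⟩ := hA
  simpa only [mul_left_comm sqrtSeries, coeff_C_mul, mul_div_mul_left _ _ hc.ne'] using
    tendsto_coeff_singularSeries_ratio hs q

end HasSingularExponent

/-! ### Maps between sets of nodes -/

/-- A set of nodes with the relations `below` (being a proper descendant) and `left` (being
incomparable and further to the left), as carried by the nodes of plane trees and forests. No axioms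
are imposed, since only maps preserving the relations are counted. -/
class PlaneRel (α : Type*) where
  below : α → α → Prop
  left : α → α → Prop

namespace PlaneRel

instance : PlaneRel Empty where
  below := fun _ _ => False
  left := fun _ _ => False

/-- `Option α` is `α` with a new root `none` above all nodes. -/
instance (α : Type*) [PlaneRel α] : PlaneRel (Option α) where
  below
    | some x, some y => below x y
    | some _, none => True
    | none, _ => False
  left
    | some x, some y => left x y
    | _, _ => False

/-- `α ⊕ β` is `α` with `β` placed to the right of it. -/
instance (α β : Type*) [PlaneRel α] [PlaneRel β] : PlaneRel (α ⊕ β) where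
  below
    | .inl x, .inl y => below x y
    | .inr x, .inr y => below x y
    | _, _ => False
  left
    | .inl x, .inl y => left x y
    | .inr x, .inr y => left x y
    | .inl _, .inr _ => True
    | .inr _, .inl _ => False

section simp_lemmas

variable {α β : Type*} [PlaneRel α] [PlaneRel β]

@[simp] theorem below_some_some {x y : α} : below (some x) (some y) ↔ below x y := Iff.rfl
@[simp] theorem below_some_none (x : α) : below (some x) none := trivial
@[simp] theorem not_below_none (x : Option α) : ¬ below none x := by cases x <;> exact id
@[simp] theorem left_some_some {x y : α} : left (some x) (some y) ↔ left x y := Iff.rfl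
@[simp] theorem not_left_none (x : Option α) : ¬ left x none := by cases x <;> exact id
@[simp] theorem not_none_left (x : Option α) : ¬ left none x := by cases x <;> exact id

@[simp] theorem below_inl_inl {x y : α} : below (.inl x : α ⊕ β) (.inl y) ↔ below x y := Iff.rfl
@[simp] theorem below_inr_inr {x y : β} : below (.inr x : α ⊕ β) (.inr y) ↔ below x y := Iff.rfl
@[simp] theorem not_below_inl_inr (x : α) (y : β) : ¬ below (.inl x : α ⊕ β) (.inr y) := id
@[simp] theorem not_below_inr_inl (x : β) (y : α) : ¬ below (.inr x : α ⊕ β) (.inl y) := id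
@[simp] theorem left_inl_inl {x y : α} : left (.inl x : α ⊕ β) (.inl y) ↔ left x y := Iff.rfl
@[simp] theorem left_inr_inr {x y : β} : left (.inr x : α ⊕ β) (.inr y) ↔ left x y := Iff.rfl
@[simp] theorem left_inl_inr (x : α) (y : β) : left (.inl x : α ⊕ β) (.inr y) := trivial
@[simp] theorem not_left_inr_inl (x : β) (y : α) : ¬ left (.inr x : α ⊕ β) (.inl y) := id

theorem isLeft_eq_of_below {x y : α ⊕ β} (h : below x y) : x.isLeft = y.isLeft := by
  rcases x with x | x <;> rcases y with y | y <;> simp_all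

theorem isRight_of_left {x y : α ⊕ β} (h : left x y) (hx : x.isRight) : y.isRight := by
  rcases x with x | x <;> rcases y with y | y <;> simp_all

end simp_lemmas

end PlaneRel

open PlaneRel

/-- Maps which preserve both relations. Between the nodes of plane trees these are the plane
embeddings. -/
@[ext]
structure PlaneHom (α β : Type*) [PlaneRel α] [PlaneRel β] where
  toFun : α → β
  map_below' : ∀ {x y}, below x y → below (toFun x) (toFun y)
  map_left' : ∀ {x y}, left x y → left (toFun x) (toFun y)

/-- Bijections which preserve and reflect both relations. -/
structure PlaneIso (α β : Type*) [PlaneRel α] [PlaneRel β] extends α ≃ β where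
  below_iff' : ∀ {x y}, below (toEquiv x) (toEquiv y) ↔ below x y
  left_iff' : ∀ {x y}, left (toEquiv x) (toEquiv y) ↔ left x y

namespace PlaneIso

variable {α α' β β' : Type*} [PlaneRel α] [PlaneRel α'] [PlaneRel β] [PlaneRel β']

instance : EquivLike (PlaneIso α β) α β where
  coe e := e.toFun
  inv e := e.invFun
  left_inv e := e.left_inv
  right_inv e := e.right_inv
  coe_injective' e e' h _ := by
    cases e
    cases e'
    congr
    exact Equiv.coe_fn_injective h

theorem below_iff (e : PlaneIso α β) {x y : α} : below (e x) (e y) ↔ below x y := e.below_iff'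

theorem left_iff (e : PlaneIso α β) {x y : α} : left (e x) (e y) ↔ left x y := e.left_iff'

/-- The identity. -/
def refl (α : Type*) [PlaneRel α] : PlaneIso α α := ⟨Equiv.refl α, Iff.rfl, Iff.rfl⟩

/-- The inverse isomorphism. -/
def symm (e : PlaneIso α β) : PlaneIso β α where
  toEquiv := e.toEquiv.symm
  below_iff' := by simp [← e.below_iff']
  left_iff' := by simp [← e.left_iff']

/-- The composition of two isomorphisms. -/
def trans (e : PlaneIso α β) (e' : PlaneIso β β') : PlaneIso α β' :=
  ⟨e.toEquiv.trans e'.toEquiv, e'.below_iff'.trans e.below_iff', e'.left_iff'.trans e.left_iff'⟩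

/-- Isomorphic summands have isomorphic ordered sums. -/
def sumCongr (e : PlaneIso α α') (e' : PlaneIso β β') : PlaneIso (α ⊕ β) (α' ⊕ β') where
  toEquiv := e.toEquiv.sumCongr e'.toEquiv
  below_iff' := by rintro (x | x) (y | y) <;> simp [e.below_iff', e'.below_iff']
  left_iff' := by rintro (x | x) (y | y) <;> simp [e.left_iff', e'.left_iff']

/-- Associativity of the ordered sum. -/
def sumAssoc (α β γ : Type*) [PlaneRel α] [PlaneRel β] [PlaneRel γ] :
    PlaneIso ((α ⊕ β) ⊕ γ) (α ⊕ (β ⊕ γ)) where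
  toEquiv := Equiv.sumAssoc α β γ
  below_iff' := by rintro ((x | x) | x) ((y | y) | y) <;> simp
  left_iff' := by rintro ((x | x) | x) ((y | y) | y) <;> simp

/-- An empty right summand can be dropped. -/
def sumEmpty (α β : Type*) [PlaneRel α] [PlaneRel β] [IsEmpty β] : PlaneIso (α ⊕ β) α where
  toEquiv := Equiv.sumEmpty α β
  below_iff' := by simp
  left_iff' := by simp

/-- An empty left summand can be dropped. -/
def emptySum (α β : Type*) [PlaneRel α] [PlaneRel β] [IsEmpty α] : PlaneIso (α ⊕ β) β where
  toEquiv := Equiv.emptySum α β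
  below_iff' := by simp
  left_iff' := by simp

end PlaneIso

namespace PlaneHom

variable {α α' β β' γ : Type*} [PlaneRel α] [PlaneRel α'] [PlaneRel β] [PlaneRel β'] [PlaneRel γ]

instance : FunLike (PlaneHom α β) α β where
  coe := toFun
  coe_injective _ _ := PlaneHom.ext

theorem map_below (f : PlaneHom α β) {x y : α} (h : below x y) : below (f x) (f y) :=
  f.map_below' h

theorem map_left (f : PlaneHom α β) {x y : α} (h : left x y) : left (f x) (f y) :=
  f.map_left' h

instance [Finite α] [Finite β] : Finite (PlaneHom α β) := DFunLike.finite _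

/-- Transport of maps along isomorphisms of the source and of the target. -/
def arrowCongr (e : PlaneIso α α') (e' : PlaneIso β β') : PlaneHom α β ≃ PlaneHom α' β' where
  toFun f := ⟨fun x => e' (f (e.symm x)),
    fun h => e'.below_iff.2 (f.map_below (e.symm.below_iff.2 h)),
    fun h => e'.left_iff.2 (f.map_left (e.symm.left_iff.2 h))⟩
  invFun f := ⟨fun x => e'.symm (f (e x)),
    fun h => e'.symm.below_iff.2 (f.map_below (e.below_iff.2 h)),
    fun h => e'.symm.left_iff.2 (f.map_left (e.left_iff.2 h))⟩
  left_inv f := by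
    ext x
    exact (e'.left_inv _).trans (congrArg f (e.left_inv x))
  right_inv f := by
    ext x
    exact (e'.right_inv _).trans (congrArg f (e.right_inv x))

theorem exists_factor {i : β → γ} (hbelow : ∀ {x y}, below (i x) (i y) → below x y)
    (hleft : ∀ {x y}, left (i x) (i y) → left x y) (f : PlaneHom α γ)
    (hf : ∀ x, f x ∈ Set.range i) : ∃ g : PlaneHom α β, ∀ x, f x = i (g x) := by
  choose g hg using hf
  exact ⟨⟨g, fun h => hbelow (by simpa only [hg] using f.map_below h),
    fun h => hleft (by simpa only [hg] using f.map_left h)⟩, fun x => (hg x).symm⟩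

end PlaneHom

namespace PlaneHom

variable {α α' β β' : Type*} [PlaneRel α] [PlaneRel α'] [PlaneRel β] [PlaneRel β']

/-- The map into `β` with a new root which avoids the root. -/
def intoOption (g : PlaneHom α β) : PlaneHom α (Option β) :=
  ⟨fun x => some (g x), g.map_below, g.map_left⟩

/-- The extension of a map by the new roots of source and target. -/
def optionMap (g : PlaneHom α β) : PlaneHom (Option α) (Option β) where
  toFun := Option.map g
  map_below' {x y} h := by cases x <;> cases y <;> simp_all [g.map_below]
  map_left' {x y} h := by cases x <;> cases y <;> simp_all [g.map_left]

/-- The ordered sum of two maps. -/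
def sumMap (g : PlaneHom α β × PlaneHom α' β') : PlaneHom (α ⊕ α') (β ⊕ β') where
  toFun := Sum.map g.1 g.2
  map_below' {x y} h := by cases x <;> cases y <;> simp_all [map_below]
  map_left' {x y} h := by cases x <;> cases y <;> simp_all [map_left]

theorem intoOption_injective : Function.Injective (intoOption (α := α) (β := β)) := fun g g' h =>
  DFunLike.ext g g' fun x => Option.some_injective _ (DFunLike.congr_fun h x)

theorem optionMap_injective : Function.Injective (optionMap (α := α) (β := β)) := fun g g' h =>
  DFunLike.ext g g' fun x => Option.some_injective _ (DFunLike.congr_fun h (some x))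

theorem sumMap_injective :
    Function.Injective (sumMap (α := α) (α' := α') (β := β) (β' := β')) := fun _ _ h =>
  Prod.ext (DFunLike.ext _ _ fun x => Sum.inl_injective (DFunLike.congr_fun h (.inl x)))
    (DFunLike.ext _ _ fun x => Sum.inr_injective (DFunLike.congr_fun h (.inr x)))

theorem ne_none_of_below {f : PlaneHom α (Option β)} {x y : α} (h : below x y) : f x ≠ none :=
  fun hx => not_below_none _ (hx ▸ f.map_below h)

theorem ne_none_of_left {f : PlaneHom α (Option β)} {x y : α} (h : left x y) :
    f x ≠ none ∧ f y ≠ none :=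
  ⟨fun hx => not_none_left _ (hx ▸ f.map_left h), fun hy => not_left_none _ (hy ▸ f.map_left h)⟩

theorem range_intoOption :
    Set.range (intoOption (α := α) (β := β)) = {f | ∀ x, f x ≠ none} := by
  ext f
  refine ⟨?_, fun hf => ?_⟩
  · rintro ⟨g, rfl⟩ x
    exact Option.some_ne_none _
  · obtain ⟨g, hg⟩ := f.exists_factor (i := some) below_some_some.1 left_some_some.1
      fun x => (Option.ne_none_iff_exists.1 (hf x))
    exact ⟨g, DFunLike.ext _ _ fun x => (hg x).symm⟩

theorem range_optionMap :
    Set.range (optionMap (α := α) (β := β)) = {f | f none = none} := by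
  ext f
  refine ⟨?_, fun hf => ?_⟩
  · rintro ⟨g, rfl⟩
    rfl
  · let f' : PlaneHom α (Option β) := ⟨fun x => f (some x),
      fun h => f.map_below (below_some_some.2 h), fun h => f.map_left (left_some_some.2 h)⟩
    obtain ⟨g, hg⟩ : f' ∈ Set.range intoOption := by
      rw [range_intoOption]
      exact fun x => ne_none_of_below (f := f) (below_some_none x)
    refine ⟨g, DFunLike.ext _ _ fun x => ?_⟩
    cases x with
    | none => exact hf.symm
    | some x => exact DFunLike.congr_fun hg x

theorem range_sumMap :
    Set.range (sumMap (α := α) (α' := α') (β := β) (β' := β')) =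
      {f | (∀ x, (f (.inl x)).isLeft) ∧ ∀ x, (f (.inr x)).isRight} := by
  ext f
  refine ⟨?_, fun ⟨hl, hr⟩ => ?_⟩
  · rintro ⟨g, rfl⟩
    exact ⟨fun _ => rfl, fun _ => rfl⟩
  · let fl : PlaneHom α (β ⊕ β') := ⟨fun x => f (.inl x),
      fun h => f.map_below (below_inl_inl.2 h), fun h => f.map_left (left_inl_inl.2 h)⟩
    let fr : PlaneHom α' (β ⊕ β') := ⟨fun x => f (.inr x),
      fun h => f.map_below (below_inr_inr.2 h), fun h => f.map_left (left_inr_inr.2 h)⟩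
    obtain ⟨gl, hgl⟩ := fl.exists_factor below_inl_inl.1 left_inl_inl.1 fun x =>
      (Sum.isLeft_iff.1 (hl x)).imp fun _ h => h.symm
    obtain ⟨gr, hgr⟩ := fr.exists_factor below_inr_inr.1 left_inr_inr.1 fun x =>
      (Sum.isRight_iff.1 (hr x)).imp fun _ h => h.symm
    refine ⟨(gl, gr), DFunLike.ext _ _ fun x => ?_⟩
    cases x with
    | inl x => exact (hgl x).symm
    | inr x => exact (hgr x).symm

theorem compl_range_optionMap :
    (Set.range (optionMap (α := α) (β := β)))ᶜ = Set.range (intoOption (α := Option α)) := by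
  rw [range_optionMap, range_intoOption]
  ext f
  refine ⟨fun hf x => ?_, fun hf => hf none⟩
  cases x with
  | none => exact hf
  | some x => exact ne_none_of_below (below_some_none x)

end PlaneHom

/-- The number of maps which preserve both relations. -/
noncomputable def homCard (α β : Type*) [PlaneRel α] [PlaneRel β] : ℕ := Nat.card (PlaneHom α β)

section homCard

variable {α α' β β' γ δ δ' σ : Type*} [PlaneRel α] [PlaneRel α'] [PlaneRel β] [PlaneRel β']
  [PlaneRel γ] [PlaneRel δ] [PlaneRel δ'] [PlaneRel σ]

theorem homCard_congr (e : PlaneIso α α') (e' : PlaneIso β β') : homCard α β = homCard α' β' :=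
  Nat.card_congr (PlaneHom.arrowCongr e e')

theorem homCard_of_isEmpty [IsEmpty α] : homCard α β = 1 := by
  have : Unique (PlaneHom α β) :=
    { default := ⟨isEmptyElim, fun {x} => isEmptyElim x, fun {x} => isEmptyElim x⟩
      uniq := fun f => PlaneHom.ext (funext isEmptyElim) }
  exact Nat.card_unique

theorem homCard_to_isEmpty [Nonempty α] [IsEmpty β] : homCard α β = 0 := by
  have : IsEmpty (PlaneHom α β) := ⟨fun f => isEmptyElim (f (Classical.arbitrary α))⟩
  exact Nat.card_of_isEmpty

theorem homCard_option_option [Finite α] [Finite β] :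
    homCard (Option α) (Option β) = homCard α β + homCard (Option α) β := by
  rw [homCard, ← Set.ncard_add_ncard_compl (Set.range PlaneHom.optionMap),
    PlaneHom.compl_range_optionMap, Set.ncard_range_of_injective PlaneHom.optionMap_injective,
    Set.ncard_range_of_injective PlaneHom.intoOption_injective, homCard, homCard]

theorem homCard_sum_option [Nonempty α] [Nonempty α'] :
    homCard (α ⊕ α') (Option β) = homCard (α ⊕ α') β := by
  have hrange : Set.range (PlaneHom.intoOption (α := α ⊕ α') (β := β)) = Set.univ := by
    rw [PlaneHom.range_intoOption, Set.eq_univ_iff_forall]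
    rintro f (x | x)
    · exact (PlaneHom.ne_none_of_left (left_inl_inr x (Classical.arbitrary α'))).1
    · exact (PlaneHom.ne_none_of_left (left_inl_inr (Classical.arbitrary α) x)).2
  rw [homCard, ← Set.ncard_univ, ← hrange,
    Set.ncard_range_of_injective PlaneHom.intoOption_injective, homCard]

/-- The number of maps from `α ⊕ δ` to `β ⊕ γ` which preserve both relations and send `α`
to `β`. -/
noncomputable def homCardLeft (α δ β γ : Type*) [PlaneRel α] [PlaneRel δ] [PlaneRel β]
    [PlaneRel γ] : ℕ :=
  {f : PlaneHom (α ⊕ δ) (β ⊕ γ) | ∀ x, (f (.inl x)).isLeft}.ncard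

theorem homCardLeft_congr (e : PlaneIso δ δ') : homCardLeft α δ β γ = homCardLeft α δ' β γ := by
  let e' := PlaneHom.arrowCongr ((PlaneIso.refl α).sumCongr e) (PlaneIso.refl (β ⊕ γ))
  rw [homCardLeft, homCardLeft, ← Set.ncard_image_of_injective _ e'.injective,
    e'.image_eq_preimage_symm]
  rfl

theorem homCardLeft_of_isEmpty_left [IsEmpty α] :
    homCardLeft α δ β γ = homCard δ (β ⊕ γ) := by
  rw [← homCard_congr (PlaneIso.emptySum α δ) (PlaneIso.refl _), homCardLeft, homCard,
    ← Set.ncard_univ]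
  simp

theorem homCardLeft_of_isEmpty_right [IsEmpty δ] : homCardLeft α δ β γ = homCard α β := by
  have h := Set.ncard_range_of_injective
    (PlaneHom.sumMap_injective (α := α) (α' := δ) (β := β) (β' := γ))
  rw [PlaneHom.range_sumMap, Nat.card_prod, ← homCard, ← homCard, homCard_of_isEmpty (α := δ),
    mul_one] at h
  rw [homCardLeft, ← h]
  simp only [IsEmpty.forall_iff, and_true]

-- A set with a root is mapped to one side; if this is the right one, then so is everything further
-- to the right.
theorem homCardLeft_sum [Finite α] [Finite σ] [Finite δ] [Finite β] [Finite γ] {r : σ}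
    (hr : ∀ x, x ≠ r → below x r) :
    homCardLeft α (σ ⊕ δ) β γ =
      homCardLeft (α ⊕ σ) δ β γ + homCard α β * homCard (σ ⊕ δ) γ := by
  have hroot (f : PlaneHom (α ⊕ (σ ⊕ δ)) (β ⊕ γ)) (x : σ) :
      (f (.inr (.inl x))).isLeft = (f (.inr (.inl r))).isLeft := by
    obtain rfl | hx := eq_or_ne x r
    · rfl
    · exact isLeft_eq_of_below (f.map_below (below_inr_inr.2 (below_inl_inl.2 (hr x hx))))
  have hleft : homCardLeft (α ⊕ σ) δ β γ =
      {f : PlaneHom (α ⊕ (σ ⊕ δ)) (β ⊕ γ) | (∀ x, (f (.inl x)).isLeft) ∧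
        (f (.inr (.inl r))).isLeft}.ncard := by
    let e := PlaneHom.arrowCongr (PlaneIso.sumAssoc α σ δ) (PlaneIso.refl (β ⊕ γ))
    rw [homCardLeft, ← Set.ncard_image_of_injective _ e.injective, e.image_eq_preimage_symm]
    congr 1 with f
    refine ⟨fun h => ⟨fun x => h (.inl x), h (.inr r)⟩, fun h => ?_⟩
    rintro (x | x)
    · exact h.1 x
    · exact (hroot f x).trans h.2
  have hright : homCard α β * homCard (σ ⊕ δ) γ =
      {f : PlaneHom (α ⊕ (σ ⊕ δ)) (β ⊕ γ) | (∀ x, (f (.inl x)).isLeft) ∧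
        ¬ (f (.inr (.inl r))).isLeft}.ncard := by
    rw [homCard, homCard, ← Nat.card_prod, ← Set.ncard_range_of_injective PlaneHom.sumMap_injective,
      PlaneHom.range_sumMap]
    congr 1 with f
    refine and_congr_right fun _ => ⟨fun h => by simpa using h (.inl r), fun h => ?_⟩
    rintro (x | x)
    · rwa [← Sum.not_isLeft, hroot f x]
    · exact isRight_of_left (f.map_left (left_inr_inr.2 (left_inl_inr r x))) (by simpa using h)
  rw [hleft, hright]
  exact (Set.ncard_inter_add_ncard_sdiff_eq_ncard _ _ (Set.toFinite _)).symm

end homCard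

/-! ### Embeddings as maps -/

theorem eq_of_range_eq_of_lt_imp_lt {α β γ : Type*} [Finite α] [LinearOrder β] [LinearOrder γ]
    {k : α → β} (hk : Function.Injective k) {f g : α → γ} (hf : ∀ x y, k x < k y → f x < f y)
    (hg : ∀ x y, k x < k y → g x < g y) (h : Set.range f = Set.range g) : f = g := by
  let _ : LinearOrder α := LinearOrder.lift' k hk
  exact (StrictMono.range_inj hf hg).1 h

namespace PlaneRel

/-- The relations on `α` induced by a map to a set of nodes. -/
abbrev comap {α β : Type*} [PlaneRel β] (f : α → β) : PlaneRel α where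
  below x y := below (f x) (f y)
  left x y := left (f x) (f y)

/-- The infinite tree of all addresses. -/
instance : PlaneRel (List ℕ) where
  below p q := q <+: p ∧ p ≠ q
  left p q := ∃ (r s t : List ℕ) (i j : ℕ), i < j ∧ p = r ++ i :: s ∧ q = r ++ j :: t

theorem below_cons_cons {i j : ℕ} {p q : List ℕ} :
    below (i :: p) (j :: q) ↔ i = j ∧ below p q := by
  simp only [below, List.cons_prefix_cons, ne_eq, List.cons.injEq]
  grind

theorem left_cons_cons {i j : ℕ} {p q : List ℕ} :
    left (i :: p) (j :: q) ↔ i < j ∨ i = j ∧ left p q := by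
  constructor
  · rintro ⟨_ | ⟨c, r⟩, s, t, a, b, hab, hp, hq⟩
    · simp_all
    · simp only [List.cons_append, List.cons.injEq] at hp hq
      exact Or.inr ⟨hp.1.trans hq.1.symm, r, s, t, a, b, hab, hp.2, hq.2⟩
  · rintro (h | ⟨rfl, r, s, t, a, b, hab, rfl, rfl⟩)
    · exact ⟨[], p, q, i, j, h, rfl, rfl⟩
    · exact ⟨i :: r, s, t, a, b, hab, rfl, rfl⟩

theorem below_cons_nil (i : ℕ) (p : List ℕ) : below (i :: p) [] :=
  ⟨List.nil_prefix, List.cons_ne_nil i p⟩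

theorem not_below_of_nil (p : List ℕ) : ¬ below [] p := fun h => h.2 (List.prefix_nil.1 h.1).symm

theorem not_left_nil (p : List ℕ) : ¬ left p [] := by
  rintro ⟨r, s, t, i, j, -, -, h⟩
  simp at h

theorem not_nil_left (p : List ℕ) : ¬ left [] p := by
  rintro ⟨r, s, t, i, j, -, h, -⟩
  simp at h

theorem left_append {p q : List ℕ} (h : left p q) (u v : List ℕ) : left (p ++ u) (q ++ v) := by
  obtain ⟨r, s, t, i, j, hij, rfl, rfl⟩ := h
  exact ⟨r, s ++ u, t ++ v, i, j, hij, by simp, by simp⟩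

theorem not_prefix_of_left {p q : List ℕ} (h : left p q) : ¬ p <+: q ∧ ¬ q <+: p := by
  obtain ⟨r, s, t, i, j, hij, rfl, rfl⟩ := h
  simp [List.prefix_append_right_inj, hij.ne, hij.ne']

theorem lt_iff_below_or_left (p q : List ℕ) : p < q ↔ below q p ∨ left p q := by
  induction p generalizing q with
  | nil => cases q <;> simp [below_cons_nil, not_below_of_nil, not_nil_left]
  | cons i p ih =>
    cases q with
    | nil => simp [not_below_of_nil, not_left_nil]
    | cons j q => rw [List.cons_lt_cons_iff, ih, below_cons_cons, left_cons_cons]; tauto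

end PlaneRel

namespace PlaneTree

variable {S T s : PlaneTree} {F : List PlaneTree}

instance (T : PlaneTree) : PlaneRel T.Vertex := .comap Vertex.address

theorem below_iff_lt {x y : T.Vertex} : below x y ↔ x < y :=
  (and_congr_right' Vertex.ext_iff.not.symm).trans (lt_iff_le_and_ne (a := x)).symm

theorem le_root (x : T.Vertex) : x ≤ T.root := List.nil_prefix

theorem isNode_cons {i : ℕ} {p : List ℕ} :
    (node F).IsNode (i :: p) ↔ ∃ h : i < F.length, (F[i]).IsNode p := by
  rw [IsNode]

theorem isNode_cons_zero {p : List ℕ} : (node (s :: F)).IsNode (0 :: p) ↔ s.IsNode p := by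
  simp [isNode_cons]

theorem isNode_cons_succ {i : ℕ} {p : List ℕ} :
    (node (s :: F)).IsNode ((i + 1) :: p) ↔ (node F).IsNode (i :: p) := by
  simp [isNode_cons]

theorem IsNode.of_append {p q : List ℕ} (h : T.IsNode (p ++ q)) : T.IsNode p := by
  induction p generalizing T with
  | nil => exact T.root.isNode
  | cons i p ih =>
    obtain ⟨F⟩ := T
    obtain ⟨hi, h⟩ := isNode_cons.1 h
    exact isNode_cons.2 ⟨hi, ih h⟩

/-- The nodes of an ordered forest: the position of a tree in the forest together with the address
of a node in that tree. -/
structure ForestVertex (F : List PlaneTree) : Type where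
  index : ℕ
  address : List ℕ
  isNode : (node F).IsNode (index :: address)

instance (F : List PlaneTree) : PlaneRel (ForestVertex F) := .comap fun x => x.index :: x.address

/-- The nodes of a tree are its root and the nodes of the forest below it. -/
def vertexIso (F : List PlaneTree) : PlaneIso (Option (ForestVertex F)) (node F).Vertex where
  toFun
    | none => (node F).root
    | some x => ⟨x.index :: x.address, x.isNode⟩
  invFun
    | ⟨[], _⟩ => none
    | ⟨i :: p, h⟩ => some ⟨i, p, h⟩
  left_inv := by rintro (_ | _) <;> rfl
  right_inv := by rintro ⟨_ | _, _⟩ <;> rfl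
  below_iff' := by
    rintro (_ | x) (_ | y)
    · exact iff_of_false (not_below_of_nil _) id
    · exact iff_of_false (not_below_of_nil _) id
    · exact iff_of_true (below_cons_nil _ _) trivial
    · exact Iff.rfl
  left_iff' := by
    rintro (_ | x) (_ | y)
    · exact iff_of_false (not_nil_left _) id
    · exact iff_of_false (not_nil_left _) id
    · exact iff_of_false (not_left_nil _) id
    · exact Iff.rfl

/-- The nodes of a forest are those of its first tree and, to the right of them, those of the
remaining forest. -/
def forestVertexConsIso (s : PlaneTree) (F : List PlaneTree) :
    PlaneIso (s.Vertex ⊕ ForestVertex F) (ForestVertex (s :: F)) where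
  toFun
    | .inl v => ⟨0, v.address, isNode_cons_zero.2 v.isNode⟩
    | .inr x => ⟨x.index + 1, x.address, isNode_cons_succ.2 x.isNode⟩
  invFun
    | ⟨0, p, h⟩ => .inl ⟨p, isNode_cons_zero.1 h⟩
    | ⟨i + 1, p, h⟩ => .inr ⟨i, p, isNode_cons_succ.1 h⟩
  left_inv := by rintro (_ | _) <;> rfl
  right_inv := by rintro ⟨_ | _, _, _⟩ <;> rfl
  below_iff' := by
    rintro (x | x) (y | y) <;> refine below_cons_cons.trans ?_
    · exact and_iff_right rfl
    · simp
    · simp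
    · exact (and_congr_left' Nat.succ_inj).trans below_cons_cons.symm
  left_iff' := by
    rintro (x | x) (y | y) <;> refine left_cons_cons.trans ?_
    · exact ⟨fun h => (h.resolve_left (lt_irrefl 0)).2, fun h => .inr ⟨rfl, h⟩⟩
    · simp
    · simp
    · exact (or_congr Nat.succ_lt_succ_iff (and_congr_left' Nat.succ_inj)).trans left_cons_cons.symm

instance : IsEmpty (ForestVertex []) := ⟨fun x => by simpa [isNode_cons] using x.isNode⟩

instance : Nonempty (ForestVertex (s :: F)) := ⟨forestVertexConsIso s F (.inl s.root)⟩

instance : Finite (ForestVertex F) :=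
  .of_injective (fun x => vertexIso F (some x))
    ((vertexIso F).toEquiv.injective.comp (Option.some_injective _))

/-- The nodes of a forest with one tree are those of the tree. -/
def forestVertexSingletonIso (s : PlaneTree) : PlaneIso (ForestVertex [s]) s.Vertex :=
  (forestVertexConsIso s []).symm.trans (.sumEmpty _ _)

section homCard

variable {α β γ : Type*} [PlaneRel α] [PlaneRel β] [PlaneRel γ]

theorem homCardLeft_forestVertex [Finite α] [Finite β] [Finite γ] (F : List PlaneTree) :
    homCardLeft α (ForestVertex F) β γ = ∑ i ∈ Finset.range (F.length + 1),
      homCard (α ⊕ ForestVertex (F.take i)) β * homCard (ForestVertex (F.drop i)) γ := by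
  induction F generalizing α with
  | nil =>
    calc homCardLeft α (ForestVertex []) β γ
      _ = homCard (α ⊕ ForestVertex []) β * homCard (ForestVertex []) γ := by
        rw [homCardLeft_of_isEmpty_right, homCard_of_isEmpty (α := ForestVertex []), mul_one,
          homCard_congr (PlaneIso.sumEmpty α (ForestVertex [])) (PlaneIso.refl β)]
      _ = _ := by
        simp only [List.length_nil, zero_add, Finset.sum_range_one]
        rfl
  | cons s F ih =>
    have hassoc (i : ℕ) : homCard ((α ⊕ s.Vertex) ⊕ ForestVertex (F.take i)) β =
        homCard (α ⊕ ForestVertex (s :: F.take i)) β :=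
      (homCard_congr (PlaneIso.sumAssoc _ _ _) (PlaneIso.refl β)).trans
        (homCard_congr ((PlaneIso.refl α).sumCongr (forestVertexConsIso s _)) (PlaneIso.refl β))
    rw [← homCardLeft_congr (forestVertexConsIso s F),
      homCardLeft_sum (r := s.root) fun x hx => below_iff_lt.2 ((le_root x).lt_of_ne hx), ih,
      List.length_cons, Finset.sum_range_succ' _ (F.length + 1),
      homCard_congr (forestVertexConsIso s F) (PlaneIso.refl γ),
      ← homCard_congr (PlaneIso.sumEmpty α (ForestVertex [])) (PlaneIso.refl β)]
    simp only [hassoc]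
    rfl

theorem homCard_forestVertex_sum [Finite β] [Finite γ] (F : List PlaneTree) :
    homCard (ForestVertex F) (β ⊕ γ) = ∑ i ∈ Finset.range (F.length + 1),
      homCard (ForestVertex (F.take i)) β * homCard (ForestVertex (F.drop i)) γ := by
  simp_rw [← homCardLeft_of_isEmpty_left (α := Empty) (δ := ForestVertex F),
    homCardLeft_forestVertex, homCard_congr (PlaneIso.emptySum Empty _) (PlaneIso.refl β)]

end homCard

theorem eq_or_below_or_left (x y : T.Vertex) :
    x = y ∨ below x y ∨ below y x ∨ left x y ∨ left y x := by
  rcases lt_trichotomy x.address y.address with h | h | h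
  · rcases (lt_iff_below_or_left _ _).1 h with h | h
    · exact .inr (.inr (.inl h))
    · exact .inr (.inr (.inr (.inl h)))
  · exact .inl (Vertex.ext h)
  · rcases (lt_iff_below_or_left _ _).1 h with h | h
    · exact .inr (.inl h)
    · exact .inr (.inr (.inr (.inr h)))

theorem leftOf_of_le_of_le {x x' y y' : T.Vertex} (h : x.LeftOf y) (hx : x' ≤ x) (hy : y' ≤ y) :
    x'.LeftOf y' := by
  obtain ⟨u, hu⟩ := hx
  obtain ⟨v, hv⟩ := hy
  have := left_append (p := x.address) (q := y.address) h u v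
  rwa [hu, hv] at this

theorem exists_leftSibling_of_leftOf {x y : T.Vertex} (h : x.LeftOf y) :
    ∃ x' y' : T.Vertex, x'.LeftSibling y' ∧ x ≤ x' ∧ y ≤ y' := by
  obtain ⟨r, s, t, i, j, hij, hx, hy⟩ := h
  rw [List.append_cons] at hx hy
  exact ⟨⟨r ++ [i], .of_append (hx ▸ x.isNode)⟩, ⟨r ++ [j], .of_append (hy ▸ y.isNode)⟩,
    ⟨r, i, j, hij, rfl, rfl⟩, ⟨s, hx.symm⟩, ⟨t, hy.symm⟩⟩

theorem hom_le_hom_iff (f : PlaneHom S.Vertex T.Vertex) {x y : S.Vertex} : f x ≤ f y ↔ x ≤ y := by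
  refine ⟨fun h => ?_, fun h => ?_⟩
  · obtain rfl | hxy | hxy | hxy | hxy := eq_or_below_or_left x y
    · exact le_rfl
    · exact (below_iff_lt.1 hxy).le
    · exact absurd h (below_iff_lt.1 (f.map_below hxy)).not_ge
    · exact absurd h (not_prefix_of_left (f.map_left hxy)).2
    · exact absurd h (not_prefix_of_left (f.map_left hxy)).1
  · obtain rfl | hxy := h.eq_or_lt
    · exact le_rfl
    · exact (below_iff_lt.1 (f.map_below (below_iff_lt.2 hxy))).le

theorem isEmbedding_iff {P : Set T.Vertex} :
    IsEmbedding S T P ↔ ∃ f : PlaneHom S.Vertex T.Vertex, Set.range f = P := by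
  constructor
  · rintro ⟨e, he⟩
    have map_left (x y : S.Vertex) (h : left x y) : left (e x : T.Vertex) (e y) := by
      obtain ⟨x', y', hsibling, hx, hy⟩ := exists_leftSibling_of_leftOf h
      exact leftOf_of_le_of_le (he x' y' hsibling) (e.monotone hx) (e.monotone hy)
    refine ⟨⟨fun x => e x, fun h => ?_, fun {x y} h => map_left x y h⟩, ?_⟩
    · exact below_iff_lt.2 (e.strictMono (below_iff_lt.1 h))
    · exact (e.surjective.range_comp Subtype.val).trans Subtype.range_val
  · rintro ⟨f, rfl⟩
    refine ⟨(OrderEmbedding.ofMapLEIff f fun _ _ => hom_le_hom_iff f).orderIso, ?_⟩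
    rintro x y ⟨q, i, j, hij, hx, hy⟩
    exact f.map_left ⟨q, [], [], i, j, hij, hx, hy⟩

theorem address_lt_of_hom (f : PlaneHom S.Vertex T.Vertex) {x y : S.Vertex}
    (h : x.address < y.address) : (f x).address < (f y).address := by
  rw [lt_iff_below_or_left] at h ⊢
  exact h.imp f.map_below f.map_left

-- A map is recovered from its range, since it preserves the lexicographic order of addresses.
theorem range_hom_injective :
    Function.Injective fun f : PlaneHom S.Vertex T.Vertex => Set.range f := by
  intro f g h
  have hrange : Set.range (Vertex.address ∘ f) = Set.range (Vertex.address ∘ g) := by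
    simpa only [Set.range_comp] using congrArg (Set.image Vertex.address) h
  have := eq_of_range_eq_of_lt_imp_lt (fun _ _ => Vertex.ext)
    (fun _ _ => address_lt_of_hom f) (fun _ _ => address_lt_of_hom g) hrange
  exact DFunLike.ext _ _ fun x => Vertex.ext (congrFun this x)

theorem numAll_eq_homCard : numAll T S = homCard S.Vertex T.Vertex := by
  rw [homCard, ← Set.ncard_range_of_injective range_hom_injective, numAll]
  exact congrArg Set.ncard (Set.ext fun P => isEmbedding_iff)

theorem root_mem_range_iff (f : PlaneHom S.Vertex T.Vertex) :
    T.root ∈ Set.range f ↔ f S.root = T.root := by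
  refine ⟨fun ⟨x, hx⟩ => ?_, fun h => ⟨_, h⟩⟩
  exact le_antisymm (le_root _) (hx ▸ (hom_le_hom_iff f).2 (le_root x))

theorem numGood_node_node (F G : List PlaneTree) :
    numGood (node G) (node F) = homCard (ForestVertex F) (ForestVertex G) := by
  let e := PlaneHom.arrowCongr (vertexIso F) (vertexIso G)
  rw [homCard, ← Set.ncard_range_of_injective PlaneHom.optionMap_injective,
    PlaneHom.range_optionMap, ← Set.ncard_image_of_injective _ e.injective,
    ← Set.ncard_image_of_injective _ range_hom_injective, numGood]
  congr 1 with P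
  have key (f) : (node G).root ∈ Set.range (e f) ↔ f none = none := by
    rw [root_mem_range_iff]
    exact (vertexIso G).toEquiv.injective.eq_iff (b := none)
  constructor
  · rintro ⟨hP, hroot⟩
    obtain ⟨f, rfl⟩ := isEmbedding_iff.1 hP
    obtain ⟨f, rfl⟩ := e.surjective f
    exact ⟨_, ⟨f, (key f).1 hroot, rfl⟩, rfl⟩
  · rintro ⟨_, ⟨f, hf, rfl⟩, rfl⟩
    exact ⟨isEmbedding_iff.2 ⟨_, rfl⟩, (key f).2 hf⟩

end PlaneTree

/-! ### Nodes and leaves -/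

namespace PlaneRel

variable {α β : Type*} [PlaneRel α] [PlaneRel β]

/-- The nodes with nothing below them. -/
def leaves (α : Type*) [PlaneRel α] : Set α := {x | ∀ y, ¬ below y x}

/-- The number of nodes plus the number of leaves. -/
noncomputable def weight (α : Type*) [PlaneRel α] : ℕ := Nat.card α + (leaves α).ncard

theorem weight_congr (e : PlaneIso α β) : weight α = weight β := by
  rw [weight, weight, Nat.card_congr e.toEquiv,
    ← Set.ncard_image_of_injective _ e.toEquiv.injective, Equiv.image_eq_preimage_symm]
  congr 2 with y
  refine e.toEquiv.forall_congr fun {x} => not_congr ?_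
  rw [← e.below_iff', e.toEquiv.apply_symm_apply]

theorem weight_of_isEmpty [IsEmpty α] : weight α = 0 := by
  rw [weight, Nat.card_of_isEmpty, Set.eq_empty_of_isEmpty (leaves α), Set.ncard_empty]

theorem weight_sum [Finite α] [Finite β] : weight (α ⊕ β) = weight α + weight β := by
  have hleaves : leaves (α ⊕ β) = Sum.inl '' leaves α ∪ Sum.inr '' leaves β := by
    ext (x | x) <;> simp [leaves]
  rw [weight, hleaves, Set.ncard_union_eq Set.disjoint_image_inl_image_inr (Set.toFinite _)
    (Set.toFinite _), Nat.card_sum, Set.ncard_image_of_injective _ Sum.inl_injective,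
    Set.ncard_image_of_injective _ Sum.inr_injective, weight, weight]
  omega

theorem weight_option_of_isEmpty [IsEmpty α] : weight (Option α) = 2 := by
  have hleaves : leaves (Option α) = {none} := by
    ext (_ | x)
    · simp [leaves, Option.forall]
    · exact isEmptyElim x
  rw [weight, hleaves, Set.ncard_singleton, Finite.card_option, Nat.card_of_isEmpty]

theorem weight_option [Finite α] [Nonempty α] : weight (Option α) = weight α + 1 := by
  have hleaves : leaves (Option α) = some '' leaves α := by
    ext (_ | x) <;> simp [leaves, Option.forall]
  rw [weight, hleaves, Set.ncard_image_of_injective _ (Option.some_injective α),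
    Finite.card_option, weight, add_right_comm]

end PlaneRel

namespace PlaneTree

variable {S T : PlaneTree}

theorem weight_forestVertex (F : List PlaneTree) :
    weight (ForestVertex F) = (F.map fun s => weight s.Vertex).sum := by
  induction F with
  | nil => exact weight_of_isEmpty
  | cons s F ih =>
    rw [← weight_congr (forestVertexConsIso s F), weight_sum, ih, List.map_cons, List.sum_cons]

theorem hom_injective (f : PlaneHom S.Vertex T.Vertex) : Function.Injective f := fun _ _ h =>
  le_antisymm ((hom_le_hom_iff f).1 h.le) ((hom_le_hom_iff f).1 h.ge)

theorem exists_leaf_le (x : T.Vertex) : ∃ y ∈ leaves T.Vertex, y ≤ x := by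
  obtain ⟨y, hyx, hmin⟩ := exists_minimal_le_of_wellFoundedLT (fun _ => True) x trivial
  exact ⟨y, fun z hz => (below_iff_lt.1 hz).not_ge (hmin.2 trivial (below_iff_lt.1 hz).le), hyx⟩

theorem le_or_le_of_le_of_le {x y z : T.Vertex} (hx : z ≤ x) (hy : z ≤ y) : x ≤ y ∨ y ≤ x :=
  (List.prefix_or_prefix_of_prefix hx hy).symm

theorem eq_of_mem_leaves_of_le {x y : T.Vertex} (hy : y ∈ leaves T.Vertex) (h : x ≤ y) : x = y :=
  h.eq_of_not_lt fun hlt => hy x (below_iff_lt.2 hlt)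

-- Leaves of `T` below the images of different leaves of `S` are different.
theorem weight_le_of_embeds (h : Embeds S T) : weight S.Vertex ≤ weight T.Vertex := by
  obtain ⟨_, hP⟩ := h
  obtain ⟨f, -⟩ := isEmbedding_iff.1 hP
  choose g hg_mem hg_le using fun x => exists_leaf_le (f x)
  refine Nat.add_le_add (Nat.card_le_card_of_injective _ (hom_injective f))
    (Set.ncard_le_ncard_of_injOn g (fun x _ => hg_mem x) (fun x hx y hy hxy => ?_) (Set.toFinite _))
  rcases le_or_le_of_le_of_le (hg_le x) (hxy ▸ hg_le y) with hle | hle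
  · exact eq_of_mem_leaves_of_le hy ((hom_le_hom_iff f).1 hle)
  · exact (eq_of_mem_leaves_of_le hx ((hom_le_hom_iff f).1 hle)).symm

/-- The exponent with which the generating function of the embeddings of `S` blows up at its
dominant singularity, as a power of `(1 - 4 X) ^ (-1)`. -/
noncomputable def exponent (S : PlaneTree) : ℝ := (weight S.Vertex - 1) / 2

theorem exponent_leaf : exponent (node []) = 1 / 2 := by
  rw [exponent, ← weight_congr (vertexIso []), weight_option_of_isEmpty]
  norm_num

theorem exponent_node {F : List PlaneTree} (hF : F ≠ []) :
    exponent (node F) = (F.map fun s => exponent s + 1 / 2).sum := by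
  obtain ⟨s, F, rfl⟩ := List.exists_cons_of_ne_nil hF
  have hsum (F : List PlaneTree) :
      ((F.map fun s => weight s.Vertex).sum : ℕ) / (2 : ℝ) =
        (F.map fun s => exponent s + 1 / 2).sum := by
    induction F with
    | nil => simp
    | cons s F ih =>
      rw [List.map_cons, List.sum_cons, List.map_cons, List.sum_cons, ← ih, exponent, Nat.cast_add]
      ring
  rw [exponent, ← weight_congr (vertexIso (s :: F)), weight_option, weight_forestVertex, ← hsum,
    Nat.cast_add, Nat.cast_one, add_sub_cancel_right]

theorem exponent_le_of_embeds (h : Embeds S T) : exponent S ≤ exponent T := by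
  unfold exponent
  gcongr
  exact weight_le_of_embeds h

theorem one_half_le_exponent (S : PlaneTree) : 1 / 2 ≤ exponent S := by
  obtain ⟨x, hx, -⟩ := exists_leaf_le S.root
  have hcard : 1 ≤ Nat.card S.Vertex := Nat.card_pos_iff.2 ⟨⟨x⟩, inferInstance⟩
  have hleaves : 1 ≤ (leaves S.Vertex).ncard := (Set.ncard_pos (Set.toFinite _)).2 ⟨x, hx⟩
  have hweight : (2 : ℝ) ≤ weight S.Vertex := by exact_mod_cast add_le_add hcard hleaves
  rw [exponent]
  linarith

end PlaneTree

/-! ### Generating functions -/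

theorem catalan_pos (n : ℕ) : 0 < catalan n := by
  rw [catalan_eq_centralBinom_div]
  exact Nat.div_pos (Nat.le_of_dvd n.centralBinom_pos n.succ_dvd_centralBinom) n.succ_pos

-- The recursion splits `F` in all ways into two nonempty parts, as in the recursion of the Catalan
-- numbers.
theorem pow_mul_eq_catalan_mul_prod {R ι : Type*} [CommSemiring R] {w x : R} {G : List ι → R}
    (hG : ∀ {n : ℕ} {F : List ι}, F.length = n + 2 → w * G F =
      x * ∑ i ∈ Finset.range (n + 1), G (F.take (i + 1)) * G (F.drop (i + 1)))
    {n : ℕ} {F : List ι} (hF : F.length = n + 1) :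
    w ^ n * G F = catalan n * x ^ n * (F.map fun s => G [s]).prod := by
  induction n using Nat.strong_induction_on generalizing F with
  | _ n ih =>
    match n with
    | 0 =>
      obtain ⟨s, rfl⟩ := List.length_eq_one_iff.1 hF
      simp
    | n + 1 =>
      have hterm : ∀ i ∈ Finset.range (n + 1),
          w ^ n * (G (F.take (i + 1)) * G (F.drop (i + 1))) =
            (catalan i * catalan (n - i) : ℕ) * (x ^ n * (F.map fun s => G [s]).prod) := by
        intro i hi
        obtain ⟨j, rfl⟩ := Nat.exists_eq_add_of_le (Nat.lt_succ_iff.1 (Finset.mem_range.1 hi))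
        have htake := ih i (by omega) (F := F.take (i + 1)) (by rw [List.length_take]; omega)
        have hdrop := ih j (by omega) (F := F.drop (i + 1)) (by rw [List.length_drop]; omega)
        have hprod := congrArg (fun F => (F.map fun s => G [s]).prod)
          (List.take_append_drop (i + 1) F)
        rw [List.map_append, List.prod_append] at hprod
        rw [← hprod, pow_add, mul_mul_mul_comm, htake, hdrop, Nat.add_sub_cancel_left]
        push_cast
        ring
      rw [pow_succ, mul_assoc, hG hF, mul_left_comm, Finset.mul_sum, Finset.sum_congr rfl hterm,
        ← Finset.sum_mul, ← Nat.cast_sum, catalan_succ, Finset.sum_range]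
      ring

namespace PlaneTree

variable {S : PlaneTree} {F : List PlaneTree}

theorem numGood_leaf (F : List PlaneTree) :
    numGood (node []) (node F) = if F = [] then 1 else 0 := by
  rw [numGood_node_node]
  cases F with
  | nil => exact homCard_of_isEmpty
  | cons s F => exact homCard_to_isEmpty

theorem numGood_branch (F : List PlaneTree) (L R : PlaneTree) :
    numGood (node [L, R]) (node F) = ∑ i ∈ Finset.range (F.length + 1),
      homCard (ForestVertex (F.take i)) L.Vertex * homCard (ForestVertex (F.drop i)) R.Vertex := by
  rw [numGood_node_node, ← homCard_forestVertex_sum]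
  exact homCard_congr (.refl _) ((forestVertexConsIso L [R]).symm.trans
    (.sumCongr (.refl _) (forestVertexSingletonIso R)))

theorem homCard_forestVertex_singleton (S T : PlaneTree) :
    homCard (ForestVertex [S]) T.Vertex = numAll T S := by
  rw [numAll_eq_homCard, homCard_congr (forestVertexSingletonIso S) (.refl _)]

theorem homCard_forestVertex_of_two_le_length (hF : 2 ≤ F.length) (T : PlaneTree) :
    homCard (ForestVertex F) T.Vertex = numGood T (node F) := by
  match F, T with
  | s :: t :: F, node G =>
    have : Nonempty s.Vertex := ⟨s.root⟩
    rw [numGood_node_node, ← homCard_congr (forestVertexConsIso s (t :: F)) (vertexIso G),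
      homCard_sum_option, homCard_congr (forestVertexConsIso s (t :: F)) (.refl _)]

theorem numAll_eq_numGood_add_numGood (T S : PlaneTree) :
    numAll T S = numGood T S + numGood T (node [S]) := by
  obtain ⟨F⟩ := S
  obtain ⟨G⟩ := T
  rw [numAll_eq_homCard, numGood_node_node, numGood_node_node,
    ← homCard_congr (vertexIso F) (vertexIso G), homCard_option_option,
    homCard_congr (vertexIso F) (.refl (ForestVertex G)),
    homCard_congr (forestVertexSingletonIso (node F)) (.refl _)]

theorem size_leaf : (node []).size = 1 := by
  rw [size, ← Nat.card_congr (vertexIso []).toEquiv, Finite.card_option, Nat.card_of_isEmpty]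

theorem size_branch (L R : PlaneTree) : (node [L, R]).size = L.size + R.size + 1 := by
  rw [size, ← Nat.card_congr (vertexIso [L, R]).toEquiv, Finite.card_option,
    ← Nat.card_congr (forestVertexConsIso L [R]).toEquiv, Nat.card_sum,
    Nat.card_congr (forestVertexSingletonIso R).toEquiv, size, size]

theorem mem_binaryTrees {n : ℕ} {T : PlaneTree} :
    T ∈ binaryTrees n ↔ T.IsBinary ∧ T.size = n := by
  simp [binaryTrees]

theorem IsBinary.odd_size {T : PlaneTree} (hT : T.IsBinary) : Odd T.size := by
  induction hT with
  | leaf => exact size_leaf ▸ odd_one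
  | branch L R _ _ hL hR => exact size_branch L R ▸ (hL.add_odd hR).add_one

theorem binaryTrees_one : binaryTrees 1 = {node []} := by
  ext T
  rw [mem_binaryTrees, Finset.mem_singleton]
  refine ⟨fun ⟨hT, hsize⟩ => ?_, fun h => h ▸ ⟨.leaf, size_leaf⟩⟩
  cases hT with
  | leaf => rfl
  | branch L R hL hR =>
    have := hL.odd_size.pos
    rw [size_branch] at hsize
    omega

theorem sum_binaryTrees_succ {M : Type*} [AddCommMonoid M] (m : ℕ) (φ : PlaneTree → M) :
    ∑ T ∈ binaryTrees (2 * (m + 1) + 1), φ T = ∑ ab ∈ antidiagonal m,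
      ∑ LR ∈ binaryTrees (2 * ab.1 + 1) ×ˢ binaryTrees (2 * ab.2 + 1), φ (node [LR.1, LR.2]) := by
  rw [Finset.sum_sigma']
  symm
  refine Finset.sum_bij (fun x _ => node [x.2.1, x.2.2]) ?_ ?_ ?_ fun _ _ => rfl
  · rintro ⟨⟨a, b⟩, L, R⟩ h
    simp only [Finset.mem_sigma, mem_antidiagonal, Finset.mem_product,
      mem_binaryTrees] at h ⊢
    obtain ⟨h, ⟨hL, hL'⟩, hR, hR'⟩ := h
    exact ⟨.branch L R hL hR, by rw [size_branch]; omega⟩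
  · rintro ⟨⟨a, b⟩, L, R⟩ h ⟨⟨a', b'⟩, L', R'⟩ h' heq
    simp only [Finset.mem_sigma, mem_antidiagonal, Finset.mem_product,
      mem_binaryTrees] at h h'
    simp only [node.injEq, List.cons.injEq, and_true] at heq
    obtain ⟨rfl, rfl⟩ := heq
    obtain rfl : a = a' := by omega
    obtain rfl : b = b' := by omega
    rfl
  · intro T hT
    obtain ⟨hT, hsize⟩ := mem_binaryTrees.1 hT
    cases hT with
    | leaf =>
      rw [size_leaf] at hsize
      omega
    | branch L R hL hR =>
      rw [size_branch] at hsize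
      obtain ⟨a, ha⟩ := hL.odd_size
      obtain ⟨b, hb⟩ := hR.odd_size
      refine ⟨⟨(a, b), L, R⟩, ?_, rfl⟩
      simp only [Finset.mem_sigma, mem_antidiagonal, Finset.mem_product, mem_binaryTrees]
      exact ⟨by omega, ⟨hL, ha⟩, hR, hb⟩

/-- The generating function of the sums of `φ` over the binary trees with `m` inner nodes, which
are the binary trees with `2 * m + 1` nodes. -/
noncomputable def genFun (φ : PlaneTree → ℕ) : ℝ⟦X⟧ :=
  mk fun m => ((∑ T ∈ binaryTrees (2 * m + 1), φ T : ℕ) : ℝ)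

theorem genFun_add (φ ψ : PlaneTree → ℕ) : genFun (fun T => φ T + ψ T) = genFun φ + genFun ψ := by
  ext m
  simp [genFun, Finset.sum_add_distrib]

theorem genFun_of_branch {φ : PlaneTree → ℕ} {k : ℕ} {α β : ℕ → PlaneTree → ℕ}
    (h : ∀ L R, φ (node [L, R]) = ∑ i ∈ Finset.range k, α i L * β i R) :
    genFun φ = C (φ (node []) : ℝ) +
      X * ∑ i ∈ Finset.range k, genFun (α i) * genFun (β i) := by
  ext m
  cases m with
  | zero => simp [genFun, binaryTrees_one]
  | succ m =>
    rw [map_add, coeff_succ_X_mul, coeff_C, if_neg m.succ_ne_zero, zero_add, map_sum,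
      genFun, coeff_mk, sum_binaryTrees_succ]
    simp only [coeff_mul, genFun, coeff_mk, h]
    rw [Finset.sum_comm]
    push_cast
    refine Finset.sum_congr rfl fun ab _ => ?_
    rw [Finset.sum_comm]
    refine Finset.sum_congr rfl fun i _ => ?_
    rw [Finset.sum_mul_sum, Finset.sum_product]

/-- The generating function of the embeddings of a forest. -/
noncomputable def forestGF (F : List PlaneTree) : ℝ⟦X⟧ :=
  genFun fun T => homCard (ForestVertex F) T.Vertex

/-- The generating function of the embeddings of a tree. -/
noncomputable def allGF (S : PlaneTree) : ℝ⟦X⟧ := genFun fun T => numAll T S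

/-- The generating function of the good embeddings of a tree. -/
noncomputable def goodGF (S : PlaneTree) : ℝ⟦X⟧ := genFun fun T => numGood T S

theorem goodGF_node (F : List PlaneTree) :
    goodGF (node F) = (if F = [] then 1 else 0) +
      X * ∑ i ∈ Finset.range (F.length + 1), forestGF (F.take i) * forestGF (F.drop i) := by
  rw [goodGF, genFun_of_branch (numGood_branch F), numGood_leaf, Nat.cast_ite, apply_ite C,
    Nat.cast_one, Nat.cast_zero, map_one, map_zero]
  rfl

theorem forestGF_nil : forestGF [] = 1 + X * forestGF [] ^ 2 := by
  have hbranch (L R : PlaneTree) : homCard (ForestVertex []) (node [L, R]).Vertex =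
      ∑ _i ∈ Finset.range 1,
        homCard (ForestVertex []) L.Vertex * homCard (ForestVertex []) R.Vertex := by
    simp only [homCard_of_isEmpty, Finset.sum_range_one, mul_one]
  conv_lhs => rw [forestGF, genFun_of_branch hbranch, homCard_of_isEmpty, Nat.cast_one, map_one,
    Finset.sum_range_one]
  rw [sq, forestGF]

theorem forestGF_singleton (S : PlaneTree) : forestGF [S] = allGF S := by
  simp only [forestGF, homCard_forestVertex_singleton, allGF]

theorem forestGF_of_two_le_length (hF : 2 ≤ F.length) : forestGF F = goodGF (node F) := by
  simp only [forestGF, goodGF, homCard_forestVertex_of_two_le_length hF]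

theorem goodGF_leaf : goodGF (node []) = forestGF [] := by
  rw [goodGF_node, if_pos rfl, forestGF_nil]
  simp [sq]

theorem sqrtSeries_eq_one_sub : sqrtSeries = 1 - 2 * X * forestGF [] := by
  refine (eq_sqrtSeries ?_ (by simp)).symm
  linear_combination 4 * X * forestGF_nil.symm

theorem goodGF_node_singleton (S : PlaneTree) :
    goodGF (node [S]) = (1 - sqrtSeries) * allGF S := by
  rw [goodGF_node, if_neg (List.cons_ne_nil _ _), sqrtSeries_eq_one_sub, List.length_singleton,
    Finset.sum_range_succ, Finset.sum_range_one]
  simp only [List.take_zero, List.drop_zero, List.take_succ_cons, List.drop_succ_cons,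
    forestGF_singleton]
  ring

theorem sqrtSeries_mul_allGF (S : PlaneTree) : sqrtSeries * allGF S = goodGF S := by
  have hsum : allGF S = goodGF S + goodGF (node [S]) := by
    rw [allGF, goodGF, goodGF, ← genFun_add]
    simp only [numAll_eq_numGood_add_numGood]
  rw [goodGF_node_singleton] at hsum
  linear_combination hsum

-- The two extreme terms of the recursion for `goodGF` contain `forestGF F` itself and are moved to
-- the other side.
theorem sqrtSeries_mul_forestGF {n : ℕ} (hF : F.length = n + 2) :
    sqrtSeries * forestGF F = X * ∑ i ∈ Finset.range (n + 1),
      forestGF (F.take (i + 1)) * forestGF (F.drop (i + 1)) := by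
  have hne : F ≠ [] := List.ne_nil_of_length_eq_add_one hF
  have h := goodGF_node F
  rw [← forestGF_of_two_le_length (by omega), if_neg hne, zero_add, hF, Finset.sum_range_succ',
    Finset.sum_range_succ, List.take_zero, List.drop_zero, List.take_of_length_le hF.le,
    List.drop_of_length_le hF.le] at h
  rw [sqrtSeries_eq_one_sub]
  linear_combination h

theorem sqrtSeries_pow_mul_X_mul_allGF_node (hF : 2 ≤ F.length) :
    sqrtSeries ^ F.length * (X * allGF (node F)) =
      C (catalan (F.length - 1) : ℝ) * (F.map fun s => X * allGF s).prod := by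
  obtain ⟨n, hn⟩ := Nat.exists_eq_add_of_lt hF
  have h := pow_mul_eq_catalan_mul_prod sqrtSeries_mul_forestGF (F := F) (n := n + 1) (by omega)
  simp only [forestGF_singleton] at h
  rw [forestGF_of_two_le_length hF, ← sqrtSeries_mul_allGF] at h
  rw [List.prod_map_mul, List.map_const', List.prod_replicate, map_natCast,
    show F.length = n + 2 by omega, Nat.add_succ_sub_one]
  linear_combination X * h

theorem hasSingularExponent_leaf : HasSingularExponent (X * allGF (node [])) (1 / 2) := by
  have h : sqrtSeries * (X * allGF (node [])) = C (1 / 2 : ℝ) * ((1 - sqrtSeries) * 1) := by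
    have hC : (2 : ℝ⟦X⟧) * C (1 / 2 : ℝ) = 1 := by
      rw [← map_ofNat C, ← map_mul, mul_one_div_cancel two_ne_zero, map_one]
    rw [mul_left_comm, sqrtSeries_mul_allGF, goodGF_leaf, sqrtSeries_eq_one_sub]
    linear_combination -(X * forestGF []) * hC
  have hright := HasSingularExponent.one.one_sub_sqrtSeries_mul.C_mul one_half_pos
  rw [← h] at hright
  simpa only [zero_add] using hright.of_sqrtSeries_mul

theorem hasSingularExponent_node_singleton {s : ℝ} (hS : HasSingularExponent (X * allGF S) s) :
    HasSingularExponent (X * allGF (node [S])) (s + 1 / 2) := by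
  refine HasSingularExponent.of_sqrtSeries_mul ?_
  rw [mul_left_comm, sqrtSeries_mul_allGF, goodGF_node_singleton, mul_left_comm]
  exact hS.one_sub_sqrtSeries_mul

theorem hasSingularExponent_node_of_two_le_length {e : PlaneTree → ℝ} (hF : 2 ≤ F.length)
    (h : ∀ s ∈ F, HasSingularExponent (X * allGF s) (e s)) :
    HasSingularExponent (X * allGF (node F)) (F.map fun s => e s + 1 / 2).sum := by
  have hprod := (HasSingularExponent.list_prod h).C_mul
    (Nat.cast_pos.2 (catalan_pos (F.length - 1)))
  rw [← sqrtSeries_pow_mul_X_mul_allGF_node hF] at hprod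
  rw [List.sum_map_add, List.map_const', List.sum_replicate, nsmul_eq_mul, mul_one_div]
  exact hprod.of_sqrtSeries_pow_mul

theorem hasSingularExponent_X_mul_allGF :
    ∀ S : PlaneTree, HasSingularExponent (X * allGF S) (exponent S)
  | node [] => exponent_leaf ▸ hasSingularExponent_leaf
  | node [s] => by
    rw [exponent_node (List.cons_ne_nil _ _), List.map_singleton, List.sum_singleton]
    exact hasSingularExponent_node_singleton (hasSingularExponent_X_mul_allGF s)
  | node (s :: t :: F) => by
    rw [exponent_node (List.cons_ne_nil _ _)]
    exact hasSingularExponent_node_of_two_le_length (by simp)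
      fun u _ => hasSingularExponent_X_mul_allGF u
termination_by S => S.size
decreasing_by
  all_goals exact size_lt_of_mem (by simp_all)

end PlaneTree

/-! ### The limit -/

namespace PlaneTree

variable {S T : PlaneTree}

theorem tendsto_oddAtTop {α : Type*} {u : ℕ → α} {l : Filter α}
    (h : Tendsto (fun m => u (2 * m + 1)) atTop l) : Tendsto u oddAtTop l := by
  intro s hs
  obtain ⟨N, hN⟩ := eventually_atTop.1 (h.eventually hs)
  rw [mem_map, oddAtTop, mem_inf_principal]
  filter_upwards [eventually_ge_atTop (2 * N + 1)] with n hn hodd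
  obtain ⟨m, rfl⟩ := hodd
  exact hN m (by omega)

theorem allB_two_mul_add_one (m : ℕ) (S : PlaneTree) :
    (allB (2 * m + 1) S : ℝ) = coeff (m + 1) (X * allGF S) := by
  rw [coeff_succ_X_mul, allGF, genFun, coeff_mk, allB]

theorem goodB_two_mul_add_one (m : ℕ) (S : PlaneTree) :
    (goodB (2 * m + 1) S : ℝ) = coeff (m + 1) (sqrtSeries * (X * allGF S)) := by
  rw [mul_left_comm, coeff_succ_X_mul, sqrtSeries_mul_allGF, goodGF, genFun, coeff_mk, goodB]

theorem exponent_pos (S : PlaneTree) : 0 < exponent S :=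
  one_half_pos.trans_le (one_half_le_exponent S)

theorem eventually_allB_pos (S : PlaneTree) : ∀ᶠ n in oddAtTop, 0 < allB n S := by
  refine tendsto_principal.1 (tendsto_oddAtTop (tendsto_principal.2 ?_))
  have hcoeff := (hasSingularExponent_X_mul_allGF S).eventually_coeff_pos (exponent_pos S)
  filter_upwards [(tendsto_add_atTop_nat 1).eventually hcoeff] with m hm
  exact Nat.cast_pos.1 (allB_two_mul_add_one m S ▸ hm)

/-- The limit of `√n · g_{B_n}(S) / a_{B_n}(S)` for odd `n` tending to infinity. -/
noncomputable def limitRatio (S : PlaneTree) : ℝ :=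
  √2 * (Real.Gamma (exponent S) / Real.Gamma (exponent S - 1 / 2))

theorem tendsto_scaledRatio (S : PlaneTree) :
    Tendsto (scaledRatio S) oddAtTop (𝓝 (limitRatio S)) := by
  refine tendsto_oddAtTop ?_
  have hsqrt : Tendsto (fun m : ℕ => √(2 - 1 / ((m : ℝ) + 1))) atTop (𝓝 √2) := by
    simpa using (tendsto_one_div_add_atTop_nhds_zero_nat.const_sub (2 : ℝ)).sqrt
  have hratio := ((hasSingularExponent_X_mul_allGF S).tendsto_coeff_ratio (exponent_pos S)).comp
    (tendsto_add_atTop_nat 1)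
  refine (hsqrt.mul hratio).congr fun m => ?_
  have hsplit : ((2 * m + 1 : ℕ) : ℝ) = (2 - 1 / ((m : ℝ) + 1)) * (m + 1 : ℕ) := by
    push_cast
    field_simp
    ring
  rw [scaledRatio, allB_two_mul_add_one, goodB_two_mul_add_one, hsplit,
    Real.sqrt_mul' _ (Nat.cast_nonneg _), mul_assoc, Function.comp_apply]

theorem limitRatio_le_of_embeds (h : Embeds S T) : limitRatio S ≤ limitRatio T :=
  mul_le_mul_of_nonneg_left
    (monotoneOn_Gamma_div_Gamma_sub one_half_pos.le (one_half_le_exponent S)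
      (one_half_le_exponent T) (exponent_le_of_embeds h)) (Real.sqrt_nonneg 2)

end PlaneTree

theorem mainTheorem3 (S₁ S₂ : PlaneTree) (hS : PlaneTree.Embeds S₁ S₂) :
    (∀ᶠ n in PlaneTree.oddAtTop, 0 < PlaneTree.allB n S₁ ∧ 0 < PlaneTree.allB n S₂) ∧
    ∃ L₁ L₂ : ℝ,
      Filter.Tendsto (PlaneTree.scaledRatio S₁) PlaneTree.oddAtTop (nhds L₁) ∧
      Filter.Tendsto (PlaneTree.scaledRatio S₂) PlaneTree.oddAtTop (nhds L₂) ∧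
      L₁ ≤ L₂ :=
  ⟨(PlaneTree.eventually_allB_pos S₁).and (PlaneTree.eventually_allB_pos S₂), _, _,
    PlaneTree.tendsto_scaledRatio S₁, PlaneTree.tendsto_scaledRatio S₂,
    PlaneTree.limitRatio_le_of_embeds hS⟩
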